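/- Let $n\ge 1$, let $T\subseteq\mathbb R$ be an interval, and let $H=H_\tau$, $\tau\in T$, be a real-analytic one-parameter family of $n\times n$ hermitian matrices with $\ddot H=0$ on $T$ (derivatives with respect to $\tau$). Let $I\subseteq\mathbb R$ be an interval containing the spectra of all $H_\tau$, $\tau\in T$, and let $F:I\to\mathbb R$ be twice differentiable and injective, with twice differentiable inverse $F^{-1}:F(I)\to I$ (derivatives are one-sided at endpoints that belong to the interval). When $F''$ has no zero, put $$A(y):=-\frac{(F^{-1})'(y)}{(F^{-1})''(y)},\qquad y\in F(I).$$ Then, with $F(H_\tau)$ defined by the functional calculus, the following hold. 1. If $F'>0$ and $F''>0$ on $I$ and $A$ is concave on $F(I)$, then $\tau\mapsto F^{-1}\big(\tfrac1n\operatorname{Tr}F(H_\tau)\big)$ is convex on $T$. 2. If $F'<0$ and $F''>0$ on $I$ and $A$ is concave on $F(I)$, then $\tau\mapsto F^{-1}\big(\tfrac1n\operatorname{Tr}F(H_\tau)\big)$ is concave on $T$. 3. If $F'>0$ and $F''<0$ on $I$ and $A$ is convex on $F(I)$, then $\tau\mapsto F^{-1}\big(\tfrac1n\operatorname{Tr}F(H_\tau)\big)$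 is concave on $T$. 4. If $F'<0$ and $F''<0$ on $I$ and $A$ is convex on $F(I)$, then $\tau\mapsto F^{-1}\big(\tfrac1n\operatorname{Tr}F(H_\tau)\big)$ is convex on $T$. -/

import Mathlib

/-- `f` is twice differentiable on the set `s` (one-sided derivatives at endpoints belonging
to `s`, when `s` is an interval). -/
def TwiceDifferentiableOn (f : ℝ → ℝ) (s : Set ℝ) : Prop :=
  DifferentiableOn ℝ f s ∧ DifferentiableOn ℝ (derivWithin f s) s

/-- `A(y) = - G'(y) / G''(y)` for a function `G` defined on `J`; used with `G` the inverse
function of `F : I → ℝ` and `J = F(I)`. -/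
noncomputable def negDerivRatio (G : ℝ → ℝ) (J : Set ℝ) (y : ℝ) : ℝ :=
  -(derivWithin G J y / derivWithin (derivWithin G J) J y)

/-- `H`, a family of `n × n` matrices with parameter in `T`, is an analytic family of
hermitian matrices. -/
def IsAnalyticHermitianFamily {n : ℕ} (H : ℝ → Matrix (Fin n) (Fin n) ℂ) (T : Set ℝ) : Prop :=
  (∀ τ ∈ T, (H τ).IsHermitian) ∧ ∀ i j, AnalyticOn ℝ (fun τ => H τ i j) T

/-- The second derivative of the matrix family `H` with respect to the parameter vanishes
on `T`. -/
def HasZeroSecondDeriv {n : ℕ} (H : ℝ → Matrix (Fin n) (Fin n) ℂ) (T : Set ℝ) : Prop :=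
  ∀ τ ∈ T, ∀ i j, derivWithin (derivWithin (fun t => H t i j) T) T τ = 0

/-- The quasi-arithmetic trace mean `G (Tr F(M) / n)` of a hermitian matrix `M`, where `F(M)` is
given by the functional calculus and `G` is the inverse function of `F`. The trace of the
hermitian matrix `F(M)` is a real number. -/
noncomputable def traceMean {n : ℕ} (F G : ℝ → ℝ) (M : Matrix (Fin n) (Fin n) ℂ) : ℝ :=
  G ((cfc F M).trace.re / n)

/-! Since `H` is affine in `τ`, no perturbation theory of eigenvalues is needed. In an eigenbasis of
`a • A + b • B`, its eigenvalues are the same combination of the diagonals of `A` and `B`, and each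
diagonal is a doubly stochastic image of the eigenvalues of its matrix. In the convex case it then
suffices that `quasiMean` is convex on `I^n` and does not increase under doubly stochastic maps
(`traceMean_combo_le`); the concave case follows by negating `G`.

Doubly stochastic maps are handled by Jensen for `F` and monotonicity of `G`. For the Hessian, `A(F
x) = F'(x)² / F''(x)`. If `F'' > 0`, Cauchy–Schwarz bounds the squared average of `F' v` by the
average of `F'' v²` times the average of `A(F xᵢ)`, and concavity of `A` bounds the latter by `A` at
the average. This fixes the sign of `F'` times the Hessian. The case `F'' < 0` is symmetric. -/

/-- A quasi-arithmetic mean of the coordinates of `x`, where `G` is the inverse of `F`. -/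
noncomputable def quasiMean {n : ℕ} (F G : ℝ → ℝ) (x : Fin n → ℝ) : ℝ :=
  G ((∑ i, F (x i)) / n)

/-! ### Averages and unique differentiability. -/

/-- `derivWithin` takes the default value 0 where derivatives are not unique, so the sign conditions
on `F'` already exclude a one-point `I`. -/
theorem uniqueDiffOn_of_derivWithin_ne_zero {I : Set ℝ} {F : ℝ → ℝ}
    (h : ∀ x ∈ I, derivWithin F I x ≠ 0) : UniqueDiffOn ℝ I := by
  intro x hx
  by_contra hc
  exact h x hx (derivWithin_zero_of_not_uniqueDiffWithinAt hc)

theorem uniqueDiffOn_of_nontrivial {J : Set ℝ} (hJ : Convex ℝ J) (h : J.Nontrivial) :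
    UniqueDiffOn ℝ J :=
  uniqueDiffOn_convex hJ (hJ.nontrivial_iff_nonempty_interior.1 h)

theorem average_mem {n : ℕ} (hn : 0 < n) {J : Set ℝ} (hJ : Convex ℝ J) {y : Fin n → ℝ}
    (hy : ∀ i, y i ∈ J) : (∑ i, y i) / n ∈ J := by
  have hn' : (n : ℝ) ≠ 0 := by positivity
  have := hJ.sum_mem (t := Finset.univ) (w := fun _ : Fin n => (n : ℝ)⁻¹) (z := y)
    (fun i _ => by positivity) (by simp [hn']) (fun i _ => hy i)
  simpa [← Finset.mul_sum, div_eq_inv_mul] using this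

theorem ConcaveOn.average_le {n : ℕ} (hn : 0 < n) {J : Set ℝ} {A : ℝ → ℝ} (hA : ConcaveOn ℝ J A)
    {y : Fin n → ℝ} (hy : ∀ i, y i ∈ J) : (∑ i, A (y i)) / n ≤ A ((∑ i, y i) / n) := by
  have hn' : (n : ℝ) ≠ 0 := by positivity
  have := hA.le_map_sum (t := Finset.univ) (w := fun _ : Fin n => (n : ℝ)⁻¹) (p := y)
    (fun i _ => by positivity) (by simp [hn']) (fun i _ => hy i)
  simpa [← Finset.mul_sum, div_eq_inv_mul] using this

/-- Cauchy–Schwarz for averages, in the form needed for second derivatives of means. -/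
theorem sq_average_mul_le {n : ℕ} {a h v : Fin n → ℝ} {C : ℝ} (hh : ∀ i, 0 < h i)
    (hC : (∑ i, a i ^ 2 / h i) / n ≤ C) :
    ((∑ i, a i * v i) / n) ^ 2 ≤ (∑ i, h i * v i ^ 2) / n * C := by
  have hcs : (∑ i, a i * v i) ^ 2 ≤ (∑ i, h i * v i ^ 2) * ∑ i, a i ^ 2 / h i := by
    refine Finset.sum_sq_le_sum_mul_sum_of_sq_le_mul _ (fun i _ => ?_) (fun i _ => ?_)
      fun i _ => ?_
    · have := hh i; positivity
    · have := hh i; positivity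
    · have := (hh i).ne'
      apply le_of_eq
      field_simp
  have h0 : 0 ≤ (∑ i, h i * v i ^ 2) / n :=
    div_nonneg (Finset.sum_nonneg fun i _ => by have := hh i; positivity) (by positivity)
  calc ((∑ i, a i * v i) / n) ^ 2 = (∑ i, a i * v i) ^ 2 / (n : ℝ) ^ 2 := by rw [div_pow]
    _ ≤ ((∑ i, h i * v i ^ 2) * ∑ i, a i ^ 2 / h i) / (n : ℝ) ^ 2 := by gcongr
    _ = (∑ i, h i * v i ^ 2) / n * ((∑ i, a i ^ 2 / h i) / n) := by ring
    _ ≤ _ := mul_le_mul_of_nonneg_left hC h0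

/-! ### Derivatives of the inverse function and the Hessian of the mean. -/

section Inverse

variable {I : Set ℝ} {F G : ℝ → ℝ}

theorem TwiceDifferentiableOn.hasDerivWithinAt (hF : TwiceDifferentiableOn F I) {x : ℝ}
    (hx : x ∈ I) : HasDerivWithinAt F (derivWithin F I x) I x :=
  (hF.1 x hx).hasDerivWithinAt

theorem TwiceDifferentiableOn.hasDerivWithinAt_derivWithin (hF : TwiceDifferentiableOn F I) {x : ℝ}
    (hx : x ∈ I) :
    HasDerivWithinAt (derivWithin F I) (derivWithin (derivWithin F I) I x) I x :=
  (hF.2 x hx).hasDerivWithinAt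

theorem TwiceDifferentiableOn.convex_image (hI : I.OrdConnected)
    (hF : TwiceDifferentiableOn F I) : Convex ℝ (F '' I) :=
  ((hI.isPreconnected.image F hF.1.continuousOn).ordConnected).convex

theorem derivWithin_leftInv_mul (hu : UniqueDiffOn ℝ I) (hF : TwiceDifferentiableOn F I)
    (hGF : Set.LeftInvOn G F I) (hG : TwiceDifferentiableOn G (F '' I)) {x : ℝ} (hx : x ∈ I) :
    derivWithin G (F '' I) (F x) * derivWithin F I x = 1 := by
  have h1 := (hG.hasDerivWithinAt (Set.mem_image_of_mem F hx)).comp x (hF.hasDerivWithinAt hx)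
    (Set.mapsTo_image F I)
  have h2 : HasDerivWithinAt (G ∘ F) 1 I x :=
    (hasDerivWithinAt_id x I).congr (fun y hy => hGF hy) (hGF hx)
  exact (hu x hx).eq_deriv _ h1 h2

theorem derivWithin_derivWithin_leftInv_mul (hu : UniqueDiffOn ℝ I)
    (hF : TwiceDifferentiableOn F I) (hGF : Set.LeftInvOn G F I)
    (hG : TwiceDifferentiableOn G (F '' I)) {x : ℝ} (hx : x ∈ I) :
    derivWithin (derivWithin G (F '' I)) (F '' I) (F x) * derivWithin F I x =
      -derivWithin (derivWithin F I) I x / derivWithin F I x ^ 2 := by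
  have hmul := fun y hy => derivWithin_leftInv_mul hu hF hGF hG (x := y) hy
  have h1 := (hG.hasDerivWithinAt_derivWithin (Set.mem_image_of_mem F hx)).comp x
    (hF.hasDerivWithinAt hx) (Set.mapsTo_image F I)
  have h2 : HasDerivWithinAt (derivWithin G (F '' I) ∘ F)
      (-derivWithin (derivWithin F I) I x / derivWithin F I x ^ 2) I x :=
    ((hF.hasDerivWithinAt_derivWithin hx).fun_inv (right_ne_zero_of_mul_eq_one (hmul x hx))).congr
      (fun y hy => eq_inv_of_mul_eq_one_left (hmul y hy)) (eq_inv_of_mul_eq_one_left (hmul x hx))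
  exact (hu x hx).eq_deriv _ h1 h2

theorem derivWithin_ne_zero_of_leftInv (hu : UniqueDiffOn ℝ I) (hF : TwiceDifferentiableOn F I)
    (hGF : Set.LeftInvOn G F I) (hG : TwiceDifferentiableOn G (F '' I)) {x : ℝ} (hx : x ∈ I) :
    derivWithin F I x ≠ 0 :=
  right_ne_zero_of_mul_eq_one (derivWithin_leftInv_mul hu hF hGF hG hx)

theorem negDerivRatio_image (hu : UniqueDiffOn ℝ I) (hF : TwiceDifferentiableOn F I)
    (hGF : Set.LeftInvOn G F I) (hG : TwiceDifferentiableOn G (F '' I)) {x : ℝ} (hx : x ∈ I) :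
    negDerivRatio G (F '' I) (F x) =
      derivWithin F I x ^ 2 / derivWithin (derivWithin F I) I x := by
  have h0 := derivWithin_ne_zero_of_leftInv hu hF hGF hG hx
  have h1 := eq_div_of_mul_eq h0 (derivWithin_leftInv_mul hu hF hGF hG hx)
  have h2 := eq_div_of_mul_eq h0 (derivWithin_derivWithin_leftInv_mul hu hF hGF hG hx)
  rw [negDerivRatio, h1, h2]
  -- When `F''` vanishes, both sides are 0 by the convention for division by zero.
  by_cases h : derivWithin (derivWithin F I) I x = 0
  · simp [h]
  · field_simp

/-- The second derivative of `quasiMean` in direction `v`. -/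
noncomputable def quasiMeanHess {n : ℕ} (F G : ℝ → ℝ) (I : Set ℝ) (x v : Fin n → ℝ) : ℝ :=
  derivWithin (derivWithin G (F '' I)) (F '' I) ((∑ i, F (x i)) / n) *
      ((∑ i, derivWithin F I (x i) * v i) / n) * ((∑ i, derivWithin F I (x i) * v i) / n) +
    derivWithin G (F '' I) ((∑ i, F (x i)) / n) *
      ((∑ i, derivWithin (derivWithin F I) I (x i) * v i ^ 2) / n)

theorem hasDerivWithinAt_quasiMean_line {n : ℕ} (hn : 0 < n) (hI : I.OrdConnected)
    (hF : TwiceDifferentiableOn F I) (hG : TwiceDifferentiableOn G (F '' I))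
    {p v : Fin n → ℝ} {S : Set ℝ} (hS : ∀ s ∈ S, ∀ i, p i + s * v i ∈ I) {s : ℝ} (hs : s ∈ S) :
    HasDerivWithinAt (fun s => quasiMean F G fun i => p i + s * v i)
      (derivWithin G (F '' I) ((∑ i, F (p i + s * v i)) / n) *
        ((∑ i, derivWithin F I (p i + s * v i) * v i) / n)) S s ∧
    HasDerivWithinAt (fun s => derivWithin G (F '' I) ((∑ i, F (p i + s * v i)) / n) *
        ((∑ i, derivWithin F I (p i + s * v i) * v i) / n))
      (quasiMeanHess F G I (fun i => p i + s * v i) v) S s := by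
  have hl : ∀ i, HasDerivWithinAt (fun s => p i + s * v i) (v i) S s := fun i => by
    simpa using ((hasDerivWithinAt_id s S).mul_const (v i)).const_add (p i)
  have hF1 : ∀ i, HasDerivWithinAt (fun s => F (p i + s * v i))
      (derivWithin F I (p i + s * v i) * v i) S s := fun i =>
    (hF.hasDerivWithinAt (hS s hs i)).comp s (hl i) fun t ht => hS t ht i
  have hF2 : ∀ i, HasDerivWithinAt (fun s => derivWithin F I (p i + s * v i) * v i)
      (derivWithin (derivWithin F I) I (p i + s * v i) * v i ^ 2) S s := fun i => by
    have := ((hF.hasDerivWithinAt_derivWithin (hS s hs i)).comp s (hl i)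
      fun t ht => hS t ht i).mul_const (v i)
    rw [mul_assoc, ← sq] at this
    exact this
  have hY : HasDerivWithinAt (fun s => (∑ i, F (p i + s * v i)) / n)
      ((∑ i, derivWithin F I (p i + s * v i) * v i) / n) S s :=
    (HasDerivWithinAt.fun_sum fun i _ => hF1 i).div_const _
  have hP : HasDerivWithinAt (fun s => (∑ i, derivWithin F I (p i + s * v i) * v i) / n)
      ((∑ i, derivWithin (derivWithin F I) I (p i + s * v i) * v i ^ 2) / n) S s :=
    (HasDerivWithinAt.fun_sum fun i _ => hF2 i).div_const _
  have hmaps : Set.MapsTo (fun s => (∑ i, F (p i + s * v i)) / n) S (F '' I) := fun t ht =>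
    average_mem hn (hF.convex_image hI) fun i => Set.mem_image_of_mem F (hS t ht i)
  have hg := HasDerivWithinAt.comp (h₂ := derivWithin G (F '' I)) s
    (hG.hasDerivWithinAt_derivWithin (hmaps hs)) hY hmaps
  exact ⟨(hG.hasDerivWithinAt (hmaps hs)).comp s hY hmaps, hg.mul hP⟩

/-- Convexity is tested on segments, where the one-variable second derivative test applies;
derivatives within `I` suffice even if the segment runs along the boundary of `I^n`. -/
theorem convexOn_quasiMean_of_hess {n : ℕ} (hn : 0 < n) (hI : I.OrdConnected)
    (hF : TwiceDifferentiableOn F I) (hG : TwiceDifferentiableOn G (F '' I))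
    (h : ∀ x v : Fin n → ℝ, (∀ i, x i ∈ I) → 0 ≤ quasiMeanHess F G I x v) :
    ConvexOn ℝ {x : Fin n → ℝ | ∀ i, x i ∈ I} (quasiMean F G) := by
  have hconv : Convex ℝ {x : Fin n → ℝ | ∀ i, x i ∈ I} := fun x hx y hy a b ha hb hab i =>
    hI.convex (hx i) (hy i) ha hb hab
  refine ⟨hconv, fun x hx y hy a b ha hb hab => ?_⟩
  have hS : ∀ s ∈ Set.Icc (0 : ℝ) 1, ∀ i, x i + s * (y i - x i) ∈ I := fun s hs i => by
    have := hI.convex (hx i) (hy i) (sub_nonneg.2 hs.2) hs.1 (sub_add_cancel 1 s)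
    simp only [smul_eq_mul] at this
    convert this using 1; ring
  have hd := fun s hs => hasDerivWithinAt_quasiMean_line hn hI hF hG hS (s := s) hs
  have hc : ConvexOn ℝ (Set.Icc (0 : ℝ) 1)
      (fun s => quasiMean F G fun i => x i + s * (y i - x i)) :=
    convexOn_of_hasDerivWithinAt2_nonneg (convex_Icc 0 1)
      (fun s hs => (hd s hs).1.continuousWithinAt)
      (fun s hs => (hd s (interior_subset hs)).1.mono interior_subset)
      (fun s hs => (hd s (interior_subset hs)).2.mono interior_subset)
      (fun s hs => h _ _ (hS s (interior_subset hs)))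
  have := hc.2 (Set.left_mem_Icc.2 zero_le_one) (Set.right_mem_Icc.2 zero_le_one) ha hb hab
  obtain rfl : a = 1 - b := by linarith
  simp only [smul_eq_mul, mul_zero, mul_one, zero_add, zero_mul, add_zero, one_mul,
    add_sub_cancel] at this ⊢
  convert this using 2
  ext i
  simp only [Pi.add_apply, Pi.smul_apply, smul_eq_mul]
  ring

theorem TwiceDifferentiableOn.neg {f : ℝ → ℝ} {s : Set ℝ} (hf : TwiceDifferentiableOn f s) :
    TwiceDifferentiableOn (fun y => -f y) s :=
  ⟨hf.1.neg, by
    have : derivWithin (fun y => -f y) s = fun y => -derivWithin f s y := by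
      ext y; exact derivWithin.fun_neg
    rw [this]; exact hf.2.neg⟩

theorem quasiMeanHess_neg_right {n : ℕ} (x v : Fin n → ℝ) :
    quasiMeanHess F (fun y => -G y) I x v = -quasiMeanHess F G I x v := by
  have : derivWithin (fun y => -G y) (F '' I) = fun y => -derivWithin G (F '' I) y := by
    ext y; exact derivWithin.fun_neg
  simp only [quasiMeanHess, this, derivWithin.fun_neg]
  ring

theorem concaveOn_quasiMean_of_hess {n : ℕ} (hn : 0 < n) (hI : I.OrdConnected)
    (hF : TwiceDifferentiableOn F I) (hG : TwiceDifferentiableOn G (F '' I))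
    (h : ∀ x v : Fin n → ℝ, (∀ i, x i ∈ I) → quasiMeanHess F G I x v ≤ 0) :
    ConcaveOn ℝ {x : Fin n → ℝ | ∀ i, x i ∈ I} (quasiMean F G) := by
  rw [← neg_convexOn_iff]
  exact convexOn_quasiMean_of_hess hn hI hF hG.neg fun x v hx => by
    rw [quasiMeanHess_neg_right]; exact neg_nonneg.2 (h x v hx)

/-- Here `X` is the mean itself. Multiplying by `F'(X)` clears the derivatives of `G` and leaves an
expression whose sign depends only on that of `F''`, so four cases become two. -/
theorem exists_derivWithin_mul_quasiMeanHess {n : ℕ} (hn : 0 < n) (hI : I.OrdConnected)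
    (hu : UniqueDiffOn ℝ I) (hF : TwiceDifferentiableOn F I)
    (hGF : Set.LeftInvOn G F I) (hG : TwiceDifferentiableOn G (F '' I)) {x : Fin n → ℝ}
    (hx : ∀ i, x i ∈ I) (v : Fin n → ℝ) :
    ∃ X ∈ I, F X = (∑ i, F (x i)) / n ∧ derivWithin F I X * quasiMeanHess F G I x v =
      (∑ i, derivWithin (derivWithin F I) I (x i) * v i ^ 2) / n -
        derivWithin (derivWithin F I) I X / derivWithin F I X ^ 2 *
          ((∑ i, derivWithin F I (x i) * v i) / n) ^ 2 := by
  obtain ⟨X, hX, hXY⟩ := average_mem hn (hF.convex_image hI)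
    fun i => Set.mem_image_of_mem F (hx i)
  refine ⟨X, hX, hXY, ?_⟩
  have h1 := derivWithin_leftInv_mul hu hF hGF hG hX
  have h2 := derivWithin_derivWithin_leftInv_mul hu hF hGF hG hX
  rw [neg_div] at h2
  rw [quasiMeanHess, ← hXY]
  linear_combination ((∑ i, derivWithin F I (x i) * v i) / n) ^ 2 * h2 +
    (∑ i, derivWithin (derivWithin F I) I (x i) * v i ^ 2) / n * h1

theorem derivWithin_mul_quasiMeanHess_nonneg {n : ℕ} (hn : 0 < n) (hI : I.OrdConnected)
    (hu : UniqueDiffOn ℝ I) (hF : TwiceDifferentiableOn F I)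
    (hGF : Set.LeftInvOn G F I) (hG : TwiceDifferentiableOn G (F '' I))
    (hF2 : ∀ x ∈ I, 0 < derivWithin (derivWithin F I) I x)
    (hA : ConcaveOn ℝ (F '' I) (negDerivRatio G (F '' I))) {x : Fin n → ℝ}
    (hx : ∀ i, x i ∈ I) (v : Fin n → ℝ) :
    ∃ X ∈ I, 0 ≤ derivWithin F I X * quasiMeanHess F G I x v := by
  obtain ⟨X, hX, hXY, h⟩ := exists_derivWithin_mul_quasiMeanHess hn hI hu hF hGF hG hx v
  refine ⟨X, hX, ?_⟩
  have hav := hA.average_le hn fun i => Set.mem_image_of_mem F (hx i)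
  rw [← hXY, negDerivRatio_image hu hF hGF hG hX] at hav
  simp only [fun i => negDerivRatio_image hu hF hGF hG (hx i)] at hav
  have hcs := sq_average_mul_le (v := v) (fun i => hF2 _ (hx i)) hav
  have h2 := hF2 X hX
  have h1 : 0 < derivWithin F I X ^ 2 := by
    have := derivWithin_ne_zero_of_leftInv hu hF hGF hG hX
    positivity
  rw [h, sub_nonneg, div_mul_eq_mul_div, div_le_iff₀ h1, mul_comm (derivWithin _ _ X)]
  rwa [mul_div_assoc', le_div_iff₀ h2] at hcs

theorem derivWithin_mul_quasiMeanHess_nonpos {n : ℕ} (hn : 0 < n) (hI : I.OrdConnected)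
    (hu : UniqueDiffOn ℝ I) (hF : TwiceDifferentiableOn F I)
    (hGF : Set.LeftInvOn G F I) (hG : TwiceDifferentiableOn G (F '' I))
    (hF2 : ∀ x ∈ I, derivWithin (derivWithin F I) I x < 0)
    (hA : ConvexOn ℝ (F '' I) (negDerivRatio G (F '' I))) {x : Fin n → ℝ}
    (hx : ∀ i, x i ∈ I) (v : Fin n → ℝ) :
    ∃ X ∈ I, derivWithin F I X * quasiMeanHess F G I x v ≤ 0 := by
  obtain ⟨X, hX, hXY, h⟩ := exists_derivWithin_mul_quasiMeanHess hn hI hu hF hGF hG hx v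
  refine ⟨X, hX, ?_⟩
  have hav := hA.neg.average_le hn fun i => Set.mem_image_of_mem F (hx i)
  simp only [Pi.neg_apply] at hav
  rw [← hXY, negDerivRatio_image hu hF hGF hG hX] at hav
  simp only [fun i => negDerivRatio_image hu hF hGF hG (hx i), ← div_neg] at hav
  -- Cauchy–Schwarz with the positive weights `-F''`; the bound is `-A`, which is concave.
  have hcs := sq_average_mul_le (v := v) (fun i => neg_pos.2 (hF2 _ (hx i))) hav
  have h2 := neg_pos.2 (hF2 X hX)
  have h1 : 0 < derivWithin F I X ^ 2 := by
    have := derivWithin_ne_zero_of_leftInv hu hF hGF hG hX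
    positivity
  rw [mul_div_assoc', le_div_iff₀ h2] at hcs
  simp only [neg_mul, Finset.sum_neg_distrib, neg_div] at hcs
  rw [h, sub_nonpos, div_mul_eq_mul_div, le_div_iff₀ h1]
  linarith

theorem TwiceDifferentiableOn.convexOn (hI : I.OrdConnected) (hF : TwiceDifferentiableOn F I)
    (h : ∀ x ∈ I, 0 < derivWithin (derivWithin F I) I x) : ConvexOn ℝ I F :=
  convexOn_of_hasDerivWithinAt2_nonneg hI.convex hF.1.continuousOn
    (fun _ hs => (hF.hasDerivWithinAt (interior_subset hs)).mono interior_subset)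
    (fun _ hs => (hF.hasDerivWithinAt_derivWithin (interior_subset hs)).mono interior_subset)
    fun _ hs => (h _ (interior_subset hs)).le

theorem TwiceDifferentiableOn.concaveOn (hI : I.OrdConnected) (hF : TwiceDifferentiableOn F I)
    (h : ∀ x ∈ I, derivWithin (derivWithin F I) I x < 0) : ConcaveOn ℝ I F :=
  concaveOn_of_hasDerivWithinAt2_nonpos hI.convex hF.1.continuousOn
    (fun _ hs => (hF.hasDerivWithinAt (interior_subset hs)).mono interior_subset)
    (fun _ hs => (hF.hasDerivWithinAt_derivWithin (interior_subset hs)).mono interior_subset)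
    fun _ hs => (h _ (interior_subset hs)).le

/-- Transfers inequalities between averages of `F` to inequalities between means. -/
theorem monotoneOn_leftInv (hI : I.OrdConnected) (hF : TwiceDifferentiableOn F I)
    (hGF : Set.LeftInvOn G F I) (h : ∀ x ∈ I, 0 < derivWithin F I x) :
    MonotoneOn G (F '' I) := by
  have hmono : StrictMonoOn F I := strictMonoOn_of_hasDerivWithinAt_pos hI.convex
    hF.1.continuousOn
    (fun _ hs => (hF.hasDerivWithinAt (interior_subset hs)).mono interior_subset)
    fun _ hs => h _ (interior_subset hs)
  rintro _ ⟨x, hx, rfl⟩ _ ⟨y, hy, rfl⟩ hxy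
  rw [hGF hx, hGF hy]
  exact (hmono.le_iff_le hx hy).1 hxy

theorem antitoneOn_leftInv (hI : I.OrdConnected) (hF : TwiceDifferentiableOn F I)
    (hGF : Set.LeftInvOn G F I) (h : ∀ x ∈ I, derivWithin F I x < 0) :
    AntitoneOn G (F '' I) := by
  have hanti : StrictAntiOn F I := strictAntiOn_of_hasDerivWithinAt_neg hI.convex
    hF.1.continuousOn
    (fun _ hs => (hF.hasDerivWithinAt (interior_subset hs)).mono interior_subset)
    fun _ hs => h _ (interior_subset hs)
  rintro _ ⟨x, hx, rfl⟩ _ ⟨y, hy, rfl⟩ hxy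
  rw [hGF hx, hGF hy]
  exact (hanti.le_iff_ge hx hy).1 hxy

end Inverse

/-! ### Doubly stochastic maps and traces of hermitian matrices. -/

section Matrix

open Matrix

variable {n : ℕ} {I : Set ℝ} {F G : ℝ → ℝ}

theorem doublyStochastic_mulVec_mem (hI : Convex ℝ I) {w : Matrix (Fin n) (Fin n) ℝ}
    (hw : w ∈ doublyStochastic ℝ (Fin n)) {x : Fin n → ℝ} (hx : ∀ j, x j ∈ I) (i : Fin n) :
    (w *ᵥ x) i ∈ I := by
  obtain ⟨h0, h1, -⟩ := mem_doublyStochastic_iff_sum.1 hw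
  exact hI.sum_mem (fun j _ => h0 i j) (h1 i) fun j _ => hx j

/-- Jensen in each row; then the column sums equal to 1 collapse the double sum. -/
theorem ConvexOn.sum_doublyStochastic_mulVec_le (hF : ConvexOn ℝ I F)
    {w : Matrix (Fin n) (Fin n) ℝ} (hw : w ∈ doublyStochastic ℝ (Fin n)) {x : Fin n → ℝ}
    (hx : ∀ j, x j ∈ I) : ∑ i, F ((w *ᵥ x) i) ≤ ∑ i, F (x i) := by
  obtain ⟨h0, h1, h2⟩ := mem_doublyStochastic_iff_sum.1 hw
  calc ∑ i, F ((w *ᵥ x) i) ≤ ∑ i, ∑ j, w i j * F (x j) :=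
        Finset.sum_le_sum fun i _ => hF.map_sum_le (fun j _ => h0 i j) (h1 i) fun j _ => hx j
    _ = ∑ j, F (x j) := by
        rw [Finset.sum_comm]
        simp [← Finset.sum_mul, h2]

/-- The diagonal of a hermitian matrix in any orthonormal basis is a doubly stochastic image of
its eigenvalues. -/
theorem Matrix.IsHermitian.exists_doublyStochastic_diag {A : Matrix (Fin n) (Fin n) ℂ}
    (hA : A.IsHermitian) (U : unitaryGroup (Fin n) ℂ) :
    ∃ w ∈ doublyStochastic ℝ (Fin n), ∀ i,
      ((star (U : Matrix (Fin n) (Fin n) ℂ) * A * U) i i).re = (w *ᵥ hA.eigenvalues) i := by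
  -- The weights are the squared moduli of the entries of the change of basis `W`; unitarity gives
  -- row and column sums 1.
  set W : unitaryGroup (Fin n) ℂ := star hA.eigenvectorUnitary * U with hW
  have hcol : ∀ i, ∑ j, Complex.normSq (W.1 j i) = 1 := fun i => by
    have h := congrFun (congrFun (mem_unitaryGroup_iff'.1 W.2) i) i
    simp only [mul_apply, star_apply, one_apply_eq, RCLike.star_def,
      ← Complex.normSq_eq_conj_mul_self] at h
    exact_mod_cast h
  have hrow : ∀ j, ∑ i, Complex.normSq (W.1 j i) = 1 := fun j => by
    have h := congrFun (congrFun (mem_unitaryGroup_iff.1 W.2) j) j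
    simp only [mul_apply, star_apply, one_apply_eq, RCLike.star_def, Complex.mul_conj] at h
    exact_mod_cast h
  refine ⟨fun i j => Complex.normSq (W.1 j i), mem_doublyStochastic_iff_sum.2
    ⟨fun i j => Complex.normSq_nonneg _, hcol, hrow⟩, fun i => ?_⟩
  have hdiag : star (U : Matrix (Fin n) (Fin n) ℂ) * A * U =
      star W.1 * diagonal (fun j => (hA.eigenvalues j : ℂ)) * W.1 := by
    have h := hA.spectral_theorem
    rw [Unitary.conjStarAlgAut_apply] at h
    conv_lhs => rw [h]
    simp [hW, mul_assoc, Function.comp_def]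
  rw [hdiag, mul_apply]
  simp only [mul_diagonal, star_apply, RCLike.star_def, mulVec, dotProduct, Complex.re_sum]
  refine Finset.sum_congr rfl fun j _ => ?_
  rw [mul_right_comm, ← Complex.normSq_eq_conj_mul_self, ← Complex.ofReal_mul, Complex.ofReal_re]

theorem Matrix.IsHermitian.diag_eigenvectorUnitary {A : Matrix (Fin n) (Fin n) ℂ}
    (hA : A.IsHermitian) (i : Fin n) :
    ((star (hA.eigenvectorUnitary : Matrix (Fin n) (Fin n) ℂ) * A * hA.eigenvectorUnitary) i i).re
      = hA.eigenvalues i := by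
  have h := hA.conjStarAlgAut_star_eigenvectorUnitary
  rw [Unitary.conjStarAlgAut_star_apply] at h
  rw [h]
  simp

theorem Matrix.IsHermitian.traceMean_eq {A : Matrix (Fin n) (Fin n) ℂ} (hA : A.IsHermitian)
    (F G : ℝ → ℝ) : traceMean F G A = quasiMean F G hA.eigenvalues := by
  rw [traceMean, quasiMean, hA.cfc_eq, Matrix.IsHermitian.cfc, Unitary.conjStarAlgAut_apply,
    trace_mul_cycle, Unitary.coe_star_mul_self, one_mul, trace_diagonal, Complex.re_sum]
  simp

theorem traceMean_combo_le (hI : I.OrdConnected)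
    (hq : ConvexOn ℝ {x : Fin n → ℝ | ∀ i, x i ∈ I} (quasiMean F G))
    (hw : ∀ w ∈ doublyStochastic ℝ (Fin n), ∀ x : Fin n → ℝ, (∀ i, x i ∈ I) →
      quasiMean F G (w *ᵥ x) ≤ quasiMean F G x)
    {A B : Matrix (Fin n) (Fin n) ℂ} (hA : A.IsHermitian) (hB : B.IsHermitian)
    (hAI : spectrum ℝ A ⊆ I) (hBI : spectrum ℝ B ⊆ I) {a b : ℝ} (ha : 0 ≤ a) (hb : 0 ≤ b)
    (hab : a + b = 1) (hM : (a • A + b • B).IsHermitian) :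
    traceMean F G (a • A + b • B) ≤ a * traceMean F G A + b * traceMean F G B := by
  obtain ⟨u, hu, hAu⟩ := hA.exists_doublyStochastic_diag hM.eigenvectorUnitary
  obtain ⟨v, hv, hBv⟩ := hB.exists_doublyStochastic_diag hM.eigenvectorUnitary
  have hAe := fun i => hAI (hA.eigenvalues_mem_spectrum_real i)
  have hBe := fun i => hBI (hB.eigenvalues_mem_spectrum_real i)
  -- The diagonal in a fixed basis is linear in the matrix, and the eigenbasis of the combination
  -- makes its diagonal the eigenvalues.
  have hMe : hM.eigenvalues = a • (u *ᵥ hA.eigenvalues) + b • (v *ᵥ hB.eigenvalues) := by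
    ext i
    rw [← hM.diag_eigenvectorUnitary i, Pi.add_apply, Pi.smul_apply, Pi.smul_apply, ← hAu, ← hBv]
    simp [mul_add, add_mul]
  rw [hM.traceMean_eq, hA.traceMean_eq, hB.traceMean_eq, hMe]
  refine (hq.2 (doublyStochastic_mulVec_mem hI.convex hu hAe)
    (doublyStochastic_mulVec_mem hI.convex hv hBe) ha hb hab).trans ?_
  exact add_le_add (mul_le_mul_of_nonneg_left (hw u hu _ hAe) ha)
    (mul_le_mul_of_nonneg_left (hw v hv _ hBe) hb)

end Matrix

/-! ### Affine families of matrices. -/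

section Family

variable {n : ℕ} {T I : Set ℝ} {F G : ℝ → ℝ} {H : ℝ → Matrix (Fin n) (Fin n) ℂ}

/-- The first derivative is a constant `c`, and then `h s - s * c` is constant. The case `x = y` is
separate because `T` may be a single point, where `derivWithin` carries no information. -/
theorem eq_combo_of_derivWithin_derivWithin_eq_zero (hT : Convex ℝ T) {h : ℝ → ℂ}
    (ha : AnalyticOn ℝ h T) (h2 : ∀ t ∈ T, derivWithin (derivWithin h T) T t = 0) {x y a b : ℝ}
    (hx : x ∈ T) (hy : y ∈ T) (ha0 : 0 ≤ a) (hb0 : 0 ≤ b) (hab : a + b = 1) :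
    h (a * x + b * y) = a * h x + b * h y := by
  have habC : (a : ℂ) + b = 1 := by exact_mod_cast hab
  rcases eq_or_ne x y with rfl | hxy
  · rw [← add_mul, ← add_mul, hab, habC, one_mul, one_mul]
  have hu : UniqueDiffOn ℝ T := uniqueDiffOn_of_nontrivial hT ⟨x, hx, y, hy, hxy⟩
  have hz : a * x + b * y ∈ T := hT hx hy ha0 hb0 hab
  have hd : DifferentiableOn ℝ h T := ha.differentiableOn
  have hd1 : DifferentiableOn ℝ (derivWithin h T) T :=
    ((ha.contDiffOn hu (n := 2)).derivWithin hu (m := 1) le_rfl).differentiableOn one_ne_zero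
  have hconst : ∀ t ∈ T, derivWithin h T t = derivWithin h T x := fun t ht =>
    hT.is_const_of_fderivWithin_eq_zero hd1 (fun s hs => by
      ext; simpa [derivWithin] using! h2 s hs) ht hx
  set c := derivWithin h T x
  have hk : ∀ t ∈ T, HasDerivWithinAt (fun s : ℝ => h s - s * c) 0 T t := fun t ht => by
    have h1 := (hd t ht).hasDerivWithinAt
    rw [hconst t ht] at h1
    have h3 : HasDerivWithinAt (fun s : ℝ => (s : ℂ) * c) (1 * c) T t :=
      (Complex.ofRealCLM.hasDerivAt.hasDerivWithinAt (x := t)).mul_const c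
    simpa using h1.fun_sub h3
  have hkc : ∀ t ∈ T, h t - t * c = h x - x * c := fun t ht =>
    hT.is_const_of_fderivWithin_eq_zero (f := fun s : ℝ => h s - s * c)
      (fun s hs => (hk s hs).differentiableWithinAt)
      (fun s hs => by
        ext; simpa [derivWithin] using! (hk s hs).derivWithin (hu s hs)) ht hx
  have e1 := hkc _ hz
  have e2 := hkc _ hy
  push_cast at e1
  linear_combination e1 - b * e2 - (h x - x * c) * habC

theorem IsAnalyticHermitianFamily.map_combo (hT : T.OrdConnected)
    (hH : IsAnalyticHermitianFamily H T) (hH2 : HasZeroSecondDeriv H T) {x y a b : ℝ}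
    (hx : x ∈ T) (hy : y ∈ T) (ha0 : 0 ≤ a) (hb0 : 0 ≤ b) (hab : a + b = 1) :
    H (a * x + b * y) = a • H x + b • H y := by
  ext i j
  simpa using eq_combo_of_derivWithin_derivWithin_eq_zero hT.convex (hH.2 i j)
    (fun t ht => hH2 t ht i j) hx hy ha0 hb0 hab

theorem convexOn_traceMean_family (hT : T.OrdConnected)
    (hH : IsAnalyticHermitianFamily H T) (hH2 : HasZeroSecondDeriv H T) (hI : I.OrdConnected)
    (hspec : ∀ τ ∈ T, spectrum ℝ (H τ) ⊆ I)
    (hq : ConvexOn ℝ {x : Fin n → ℝ | ∀ i, x i ∈ I} (quasiMean F G))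
    (hw : ∀ w ∈ doublyStochastic ℝ (Fin n), ∀ x : Fin n → ℝ, (∀ i, x i ∈ I) →
      quasiMean F G (w.mulVec x) ≤ quasiMean F G x) :
    ConvexOn ℝ T fun τ => traceMean F G (H τ) := by
  refine ⟨hT.convex, fun x hx y hy a b ha hb hab => ?_⟩
  have hz := hH.1 _ (hT.convex hx hy ha hb hab)
  simp only [smul_eq_mul] at hz ⊢
  rw [hH.map_combo hT hH2 hx hy ha hb hab] at hz ⊢
  exact traceMean_combo_le hI hq hw (hH.1 x hx) (hH.1 y hy) (hspec x hx) (hspec y hy) ha hb hab hz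

theorem concaveOn_traceMean_family (hT : T.OrdConnected)
    (hH : IsAnalyticHermitianFamily H T) (hH2 : HasZeroSecondDeriv H T) (hI : I.OrdConnected)
    (hspec : ∀ τ ∈ T, spectrum ℝ (H τ) ⊆ I)
    (hq : ConcaveOn ℝ {x : Fin n → ℝ | ∀ i, x i ∈ I} (quasiMean F G))
    (hw : ∀ w ∈ doublyStochastic ℝ (Fin n), ∀ x : Fin n → ℝ, (∀ i, x i ∈ I) →
      quasiMean F G x ≤ quasiMean F G (w.mulVec x)) :
    ConcaveOn ℝ T fun τ => traceMean F G (H τ) := by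
  rw [← neg_convexOn_iff]
  -- The convex version does not require `G` to invert `F`, so it applies to `-G`.
  exact convexOn_traceMean_family (G := fun y => -G y) hT hH hH2 hI hspec hq.neg
    fun w hw' x hx => neg_le_neg (hw w hw' x hx)

end Family

/-! ### The four sign cases. -/

theorem mainTheorem9 (n : ℕ) (hn : 0 < n)
    (T : Set ℝ) (hT : T.OrdConnected)
    (H : ℝ → Matrix (Fin n) (Fin n) ℂ) (hH : IsAnalyticHermitianFamily H T)
    (hH2 : HasZeroSecondDeriv H T)
    (I : Set ℝ) (hI : I.OrdConnected) (hspec : ∀ τ ∈ T, spectrum ℝ (H τ) ⊆ I)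
    (F G : ℝ → ℝ) (hF : TwiceDifferentiableOn F I)
    (hGF : Set.LeftInvOn G F I) (hG : TwiceDifferentiableOn G (F '' I)) :
    ((∀ x ∈ I, 0 < derivWithin F I x) → (∀ x ∈ I, 0 < derivWithin (derivWithin F I) I x) →
      ConcaveOn ℝ (F '' I) (negDerivRatio G (F '' I)) →
      ConvexOn ℝ T (fun τ => traceMean F G (H τ))) ∧
    ((∀ x ∈ I, derivWithin F I x < 0) → (∀ x ∈ I, 0 < derivWithin (derivWithin F I) I x) →
      ConcaveOn ℝ (F '' I) (negDerivRatio G (F '' I)) →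
      ConcaveOn ℝ T (fun τ => traceMean F G (H τ))) ∧
    ((∀ x ∈ I, 0 < derivWithin F I x) → (∀ x ∈ I, derivWithin (derivWithin F I) I x < 0) →
      ConvexOn ℝ (F '' I) (negDerivRatio G (F '' I)) →
      ConcaveOn ℝ T (fun τ => traceMean F G (H τ))) ∧
    ((∀ x ∈ I, derivWithin F I x < 0) → (∀ x ∈ I, derivWithin (derivWithin F I) I x < 0) →
      ConvexOn ℝ (F '' I) (negDerivRatio G (F '' I)) →
      ConvexOn ℝ T (fun τ => traceMean F G (H τ))) := by
  have havg : ∀ x : Fin n → ℝ, (∀ i, x i ∈ I) → (∑ i, F (x i)) / n ∈ F '' I := fun x hx =>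
    average_mem hn (hF.convex_image hI) fun i => Set.mem_image_of_mem F (hx i)
  have hmem : ∀ w ∈ doublyStochastic ℝ (Fin n), ∀ x : Fin n → ℝ, (∀ i, x i ∈ I) →
      ∀ i, w.mulVec x i ∈ I := fun w hw x hx => doublyStochastic_mulVec_mem hI.convex hw hx
  have hle : (∀ x ∈ I, 0 < derivWithin (derivWithin F I) I x) →
      ∀ w ∈ doublyStochastic ℝ (Fin n), ∀ x : Fin n → ℝ, (∀ i, x i ∈ I) →
        (∑ i, F (w.mulVec x i)) / n ≤ (∑ i, F (x i)) / n := fun h w hw x hx =>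
    div_le_div_of_nonneg_right
      ((hF.convexOn hI h).sum_doublyStochastic_mulVec_le hw hx) n.cast_nonneg
  have hge : (∀ x ∈ I, derivWithin (derivWithin F I) I x < 0) →
      ∀ w ∈ doublyStochastic ℝ (Fin n), ∀ x : Fin n → ℝ, (∀ i, x i ∈ I) →
        (∑ i, F (x i)) / n ≤ (∑ i, F (w.mulVec x i)) / n := fun h w hw x hx => by
    have := (hF.concaveOn hI h).neg.sum_doublyStochastic_mulVec_le hw hx
    simp only [Pi.neg_apply, Finset.sum_neg_distrib, neg_le_neg_iff] at this
    exact div_le_div_of_nonneg_right this n.cast_nonneg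
  -- The sign of `F''` determines the sign of `F'` times the Hessian and the direction of `hle` or
  -- `hge`; the sign of `F'` decides whether passing to the mean reverses both.
  refine ⟨fun h1 h2 hA => ?_, fun h1 h2 hA => ?_, fun h1 h2 hA => ?_, fun h1 h2 hA => ?_⟩
  · have hu := uniqueDiffOn_of_derivWithin_ne_zero fun x hx => (h1 x hx).ne'
    refine convexOn_traceMean_family hT hH hH2 hI hspec
      (convexOn_quasiMean_of_hess hn hI hF hG fun x v hx => ?_) fun w hw x hx =>
      monotoneOn_leftInv hI hF hGF h1 (havg _ (hmem w hw x hx)) (havg x hx) (hle h2 w hw x hx)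
    obtain ⟨X, hX, h⟩ := derivWithin_mul_quasiMeanHess_nonneg hn hI hu hF hGF hG h2 hA hx v
    exact nonneg_of_mul_nonneg_right h (h1 X hX)
  · have hu := uniqueDiffOn_of_derivWithin_ne_zero fun x hx => (h1 x hx).ne
    refine concaveOn_traceMean_family hT hH hH2 hI hspec
      (concaveOn_quasiMean_of_hess hn hI hF hG fun x v hx => ?_) fun w hw x hx =>
      antitoneOn_leftInv hI hF hGF h1 (havg _ (hmem w hw x hx)) (havg x hx) (hle h2 w hw x hx)
    obtain ⟨X, hX, h⟩ := derivWithin_mul_quasiMeanHess_nonneg hn hI hu hF hGF hG h2 hA hx v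
    have := h1 X hX
    by_contra! hc
    exact (mul_neg_of_neg_of_pos this hc).not_ge h
  · have hu := uniqueDiffOn_of_derivWithin_ne_zero fun x hx => (h1 x hx).ne'
    refine concaveOn_traceMean_family hT hH hH2 hI hspec
      (concaveOn_quasiMean_of_hess hn hI hF hG fun x v hx => ?_) fun w hw x hx =>
      monotoneOn_leftInv hI hF hGF h1 (havg x hx) (havg _ (hmem w hw x hx)) (hge h2 w hw x hx)
    obtain ⟨X, hX, h⟩ := derivWithin_mul_quasiMeanHess_nonpos hn hI hu hF hGF hG h2 hA hx v
    by_contra! hc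
    exact (mul_pos (h1 X hX) hc).not_ge h
  · have hu := uniqueDiffOn_of_derivWithin_ne_zero fun x hx => (h1 x hx).ne
    refine convexOn_traceMean_family hT hH hH2 hI hspec
      (convexOn_quasiMean_of_hess hn hI hF hG fun x v hx => ?_) fun w hw x hx =>
      antitoneOn_leftInv hI hF hGF h1 (havg x hx) (havg _ (hmem w hw x hx)) (hge h2 w hw x hx)
    obtain ⟨X, hX, h⟩ := derivWithin_mul_quasiMeanHess_nonpos hn hI hu hF hGF hG h2 hA hx v
    by_contra! hc
    exact (mul_pos_of_neg_of_neg (h1 X hX) hc).not_ge h
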